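/- Let $\mathcal H=\mathcal H_1\otimes\dots\otimes\mathcal H_n$ be a tensor product of finite-dimensional complex Hilbert spaces, let $\psi\in\mathcal H$ be a unit vector and $\rho=|\psi\rangle\langle\psi|$. For $I\subseteq\{1,\dots,n\}$ let $\mathcal H_I=\bigotimes_{i\in I}\mathcal H_i$ (so $\mathcal H_\emptyset=\mathbb C$), let $\rho_I$ be the partial trace of $\rho$ over the subsystems outside $I$, let $s_I$ be the orthogonal projection onto the image of $\rho_I$, and put $O|_{\rho_I}=s_IOs_I$ for an operator $O$ on $\mathcal H_I$. For $0\le k\le n$, the space $\Omega^k$ of entanglement $k$-forms consists of the tuples $\omega=(\omega_I)_{|I|=k}$ in which each $\omega_I$ has the form $O|_{\rho_I}$ (so $\Omega^0=\mathbb C$); put $\Omega^{n+1}=0$. For operators $A$ on $\mathcal H_I$ and $B$ on $\mathcal H_J$ let $A\,\widehat\otimes\,B$ be $0$ if $I\cap J\ne\emptyset$, and otherwise the tensor product of $A$ and $B$ with its factors put in increasing order, multiplied by the sign of the permutation that sorts the concatenation of the increasing lists of $I$ and of $J$. The coboundary operator $d:\Omega^k\to\Omega^{k+1}$ is $$(d\omega)_K=\Big(c_k\sum_{j\in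 K}\mathbb I_j\,\widehat\otimes\,\omega_{K\setminus\{j\}}\Big)\Big|_{\rho_K},\qquad c_0=1,\quad c_k=k\ \ (k\ge1).$$ For $|I|=k$ choose a Schmidt decomposition $\psi=\sum_{\alpha=1}^S\lambda_\alpha|\alpha_I\rangle\otimes|\alpha_{I^C}\rangle$ with all $\lambda_\alpha>0$ (tensor factors rearranged in increasing order, without a sign). The Hodge star $*:\Omega^k\to\Omega^{n-k}$ is the conjugate-linear map $$(*\omega)_{I^C}=(-1)^\sigma\sum_{\alpha,\beta=1}^S\overline{\langle\alpha_I|\omega_I|\beta_I\rangle}\;|\alpha_{I^C}\rangle\langle\beta_{I^C}|,$$ where $\sigma$ is the permutation that sorts the concatenation of the increasing lists of $I$ and of $I^C$. The wedge product of $\omega\in\Omega^p$ and $\eta\in\Omega^q$ is $(\omega\wedge\eta)_K=\big(\sum_{I\cup J=K}\omega_I\,\widehat\otimes\,\eta_J\big)\big|_{\rho_K}$ for $|K|=p+q$, and $\langle\omega,\eta\rangle=\operatorname{tr}\big((\omega\wedge *\eta)|_\rho\big)$ for $\omega,\eta\in\Omega^k$; this is a positive definite sesquilinear form. Let $\delta:\Omega^{k+1}\to\Omega^k$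 be the adjoint of $d$, that is, $\langle\omega,d\eta\rangle=\langle\delta\omega,\eta\rangle$, with $\delta=0$ on $\Omega^0$, and let $\mathrm{Harm}^k=\{\omega\in\Omega^k: d\omega=0=\delta\omega\}$ be the space of harmonic $k$-forms. **Theorem (Hodge duality).** For every $k$ with $0\le k\le n$, the Hodge star $*:\Omega^k\to\Omega^{n-k}$ does not depend on the choice of the Schmidt decompositions, and it maps $\mathrm{Harm}^k$ bijectively onto $\mathrm{Harm}^{n-k}$. Moreover, $\mathrm{Harm}^k\cong\mathrm{Harm}^{n-k}$ as complex vector spaces. -/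

import Mathlib

namespace EntanglementHodge

noncomputable section

/-- The support projection `s_ρ`: the orthogonal projection onto the image of `ρ`. -/
def suppProj {X : Type*} [Fintype X] [DecidableEq X] (ρ : Matrix X X ℂ) : Matrix X X ℂ :=
  (Matrix.toEuclideanCLM (n := X) (𝕜 := ℂ)).symm
    (LinearMap.range (Matrix.toEuclideanLin ρ)).starProjection

/-- The operator `|u⟩⟨v|`. -/
def ketBra {X : Type*} (u v : EuclideanSpace ℂ X) : Matrix X X ℂ :=
  Matrix.vecMulVec u.ofLp (star v.ofLp)

/-- The matrix element `⟨u| A |v⟩`. -/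
def matElem {X : Type*} [Fintype X] (u : EuclideanSpace ℂ X) (A : Matrix X X ℂ)
    (v : EuclideanSpace ℂ X) : ℂ :=
  star u.ofLp ⬝ᵥ A.mulVec v.ofLp

theorem suppProj_eq {X : Type*} [Fintype X] [DecidableEq X] {ρ P Y : Matrix X X ℂ}
    (h1 : P.conjTranspose = P) (h2 : P * P = P) (h3 : P * ρ = ρ) (h4 : ρ * Y = P) :
    suppProj ρ = P := by
  have hP : IsStarProjection (Matrix.toEuclideanCLM (n := X) (𝕜 := ℂ) P) :=
    (show IsStarProjection P from ⟨h2, h1⟩).map (Matrix.toEuclideanCLM (n := X) (𝕜 := ℂ))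
  have hr : LinearMap.range (Matrix.toEuclideanLin ρ)
      = LinearMap.range (Matrix.toEuclideanLin P) := by
    apply le_antisymm
    · rintro _ ⟨v, rfl⟩
      refine ⟨Matrix.toEuclideanLin ρ v, ?_⟩
      rw [← Matrix.coe_toEuclideanCLM_eq_toEuclideanLin, ← Matrix.coe_toEuclideanCLM_eq_toEuclideanLin]
      conv_rhs => rw [← h3, map_mul]
      rfl
    · rintro _ ⟨v, rfl⟩
      refine ⟨Matrix.toEuclideanLin Y v, ?_⟩
      rw [← Matrix.coe_toEuclideanCLM_eq_toEuclideanLin, ← Matrix.coe_toEuclideanCLM_eq_toEuclideanLin,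
        ← Matrix.coe_toEuclideanCLM_eq_toEuclideanLin]
      conv_rhs => rw [← h4, map_mul]
      rfl
  obtain ⟨_, h⟩ := isStarProjection_iff_eq_starProjection_range.mp hP
  unfold suppProj
  rw [StarAlgEquiv.symm_apply_eq]
  rw [h]
  congr 1

theorem ketBra_mul {X : Type*} [Fintype X] (a b u v : EuclideanSpace ℂ X) :
    ketBra a b * ketBra u v = inner ℂ b u • ketBra a v := by
  ext i j
  simp only [ketBra, Matrix.mul_apply, Matrix.vecMulVec_apply, Matrix.smul_apply, PiLp.inner_apply,
    RCLike.inner_apply, smul_eq_mul, Finset.sum_mul, Pi.star_apply]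
  refine Finset.sum_congr rfl fun x _ => ?_
  simp only [starRingEnd_apply]
  ring

theorem suppProj_spectral {X : Type*} [Fintype X] [DecidableEq X] {r : ℕ}
    (u : Fin r → EuclideanSpace ℂ X) (hu : Orthonormal ℂ u) (c : Fin r → ℂ) (hc : ∀ a, c a ≠ 0) :
    suppProj (∑ a, c a • ketBra (u a) (u a)) = ∑ a, ketBra (u a) (u a) := by
  have key : ∀ f g : Fin r → ℂ, (∑ a, f a • ketBra (u a) (u a)) * (∑ a, g a • ketBra (u a) (u a))
      = ∑ a, (f a * g a) • ketBra (u a) (u a) := by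
    intro f g
    simp only [Finset.sum_mul, Finset.mul_sum, smul_mul_assoc, mul_smul_comm, ketBra_mul,
      orthonormal_iff_ite.mp hu]
    simp [smul_smul, mul_comm]
  have one : ∑ a, ketBra (u a) (u a) = ∑ a, (1 : ℂ) • ketBra (u a) (u a) := by simp
  refine suppProj_eq (Y := ∑ a, (c a)⁻¹ • ketBra (u a) (u a)) ?_ ?_ ?_ ?_
  · rw [Matrix.conjTranspose_sum]
    refine Finset.sum_congr rfl fun a _ => ?_
    ext i j
    simp [ketBra, Matrix.vecMulVec_apply, mul_comm]
  · rw [one, key]; simp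
  · rw [one, key]; simp
  · rw [key, one]; simp [hc]

theorem exists_svd {X Y : Type*} [Fintype X] [Fintype Y] [DecidableEq X] (M : Matrix X Y ℂ) :
    ∃ (r : ℕ) (c : Fin r → ℝ) (u : Fin r → EuclideanSpace ℂ X) (v : Fin r → EuclideanSpace ℂ Y),
      (∀ a, 0 < c a) ∧ Orthonormal ℂ u ∧ Orthonormal ℂ v ∧
        ∀ x y, M x y = ∑ a, (c a : ℂ) * u a x * v a y := by
  have hA : (M * M.conjTranspose).IsHermitian := Matrix.isHermitian_mul_conjTranspose_self M
  set w := hA.eigenvectorBasis with hw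
  set μ := hA.eigenvalues with hμ
  let g : X → Y → ℂ := fun a y => ∑ x, star (w a x) * M x y
  have hg : ∀ a b, ∑ y, star (g a y) * g b y = if a = b then (μ a : ℂ) else 0 := by
    intro a b
    have h1 := hA.mulVec_eigenvectorBasis a
    have h2 : ∑ x, star (w b x) * (μ a * w a x) = if a = b then (μ a : ℂ) else 0 := by
      have := orthonormal_iff_ite.mp w.orthonormal b a
      rw [PiLp.inner_apply] at this
      simp only [RCLike.inner_apply] at this
      have h3 : ∑ x, star (w b x) * (μ a * w a x) = μ a * ∑ x, w a x * (starRingEnd ℂ) (w b x) := by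
        rw [Finset.mul_sum]
        exact Finset.sum_congr rfl fun x _ => by simp only [starRingEnd_apply]; ring
      rw [h3, this]
      by_cases h : a = b
      · simp [h]
      · simp [h, Ne.symm h]
    rw [← h2]
    have h4 : ∀ x, (μ a : ℂ) * w a x = ∑ y, M x y * ∑ x', star (M x' y) * w a x' := by
      intro x
      have := congrFun h1 x
      simp only [Pi.smul_apply, Complex.real_smul] at this
      rw [hw, hμ, ← this, ← Matrix.mulVec_mulVec]
      rfl
    simp only [h4, g, star_sum, star_mul', star_star, Finset.mul_sum, Finset.sum_mul]
    rw [Finset.sum_comm]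
    rw [Finset.sum_comm]
    conv_rhs => rw [Finset.sum_comm]
    refine Finset.sum_congr rfl fun y _ => ?_
    refine Finset.sum_congr rfl fun x _ => ?_
    refine Finset.sum_congr rfl fun x' _ => ?_
    ring
  have hnn : ∀ a, 0 ≤ μ a := fun a => by
    have h := hg a a
    simp only [if_true] at h
    have : (∑ y, ‖g a y‖ ^ 2 : ℝ) = μ a := by
      have h' : ((∑ y, ‖g a y‖ ^ 2 : ℝ) : ℂ) = μ a := by
        rw [← h]; push_cast
        refine Finset.sum_congr rfl fun y _ => ?_
        rw [← Complex.conj_mul']; rfl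
      exact_mod_cast h'
    rw [← this]; positivity
  have hz : ∀ a, μ a = 0 → ∀ y, g a y = 0 := fun a ha y => by
    have h := hg a a
    simp only [if_true, ha] at h
    have h' : (∑ y, ‖g a y‖ ^ 2 : ℝ) = 0 := by
      have h' : ((∑ y, ‖g a y‖ ^ 2 : ℝ) : ℂ) = 0 := by
        rw [← Complex.ofReal_zero, ← h]; push_cast
        refine Finset.sum_congr rfl fun y _ => ?_
        rw [← Complex.conj_mul']; rfl
      exact_mod_cast h'
    rw [Finset.sum_eq_zero_iff_of_nonneg (fun _ _ => by positivity)] at h'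
    simpa using h' y (Finset.mem_univ _)
  have hM : ∀ x y, M x y = ∑ a, w a x * g a y := by
    intro x y
    have h := w.sum_repr' (WithLp.toLp 2 fun x => M x y)
    have h' := congrArg (fun v : EuclideanSpace ℂ X => v x) h
    simp only at h'
    rw [← h']
    rw [WithLp.ofLp_sum, Finset.sum_apply]
    refine Finset.sum_congr rfl fun a _ => ?_
    simp only [PiLp.smul_apply, PiLp.inner_apply, RCLike.inner_apply, smul_eq_mul, g,
      starRingEnd_apply]
    rw [mul_comm]
    congr 1
    exact Finset.sum_congr rfl fun _ _ => mul_comm _ _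
  let T := {a : X // μ a ≠ 0}
  let e : T ≃ Fin (Fintype.card T) := Fintype.equivFin T
  have hpos : ∀ t : T, 0 < √(μ t.1) := fun t =>
    Real.sqrt_pos.mpr (lt_of_le_of_ne (hnn _) (Ne.symm t.2))
  refine ⟨Fintype.card T, fun i => √(μ (e.symm i).1), fun i => w (e.symm i).1,
    fun i => WithLp.toLp 2 fun y => ((√(μ (e.symm i).1) : ℝ) : ℂ)⁻¹ * g (e.symm i).1 y,
    fun i => hpos _, ?_, ?_, ?_⟩
  · exact w.orthonormal.comp _ (Subtype.val_injective.comp e.symm.injective)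
  · rw [orthonormal_iff_ite]
    intro i j
    rw [PiLp.inner_apply]
    simp only [RCLike.inner_apply]
    have : ∀ y, ((√(μ (e.symm j).1) : ℝ) : ℂ)⁻¹ * g (e.symm j).1 y *
        (starRingEnd ℂ) (((√(μ (e.symm i).1) : ℝ) : ℂ)⁻¹ * g (e.symm i).1 y)
        = ((√(μ (e.symm j).1) : ℝ) : ℂ)⁻¹ * ((√(μ (e.symm i).1) : ℝ) : ℂ)⁻¹ *
          (star (g (e.symm i).1 y) * g (e.symm j).1 y) := by
      intro y
      simp only [map_mul, map_inv₀, starRingEnd_apply]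
      rw [show star ((√(μ (e.symm i).1) : ℝ) : ℂ) = ((√(μ (e.symm i).1) : ℝ) : ℂ) from
        Complex.conj_ofReal _]
      ring
    simp only [this, ← Finset.mul_sum, hg]
    by_cases h : i = j
    · subst h
      simp only [if_true]
      have h5 : ((μ (e.symm i).1 : ℝ) : ℂ) = ((√(μ (e.symm i).1) : ℝ) : ℂ) * ((√(μ (e.symm i).1) : ℝ) : ℂ) := by
        rw [← Complex.ofReal_mul, Real.mul_self_sqrt (hnn _)]
      have h6 : ((√(μ (e.symm i).1) : ℝ) : ℂ) ≠ 0 := by exact_mod_cast (hpos (e.symm i)).ne'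
      rw [h5]; field_simp
    · have : (e.symm i).1 ≠ (e.symm j).1 := fun h' => h (e.symm.injective (Subtype.ext h'))
      simp [h, this]
  · intro x y
    rw [hM, e.symm.sum_comp (fun t : T => ((√(μ t.1) : ℝ) : ℂ) * w t.1 x *
      (WithLp.toLp 2 fun y => ((√(μ t.1) : ℝ) : ℂ)⁻¹ * g t.1 y : EuclideanSpace ℂ Y) y)]
    have h7 : ∀ t : T, ((√(μ t.1) : ℝ) : ℂ) * w t.1 x *
      (WithLp.toLp 2 fun y => ((√(μ t.1) : ℝ) : ℂ)⁻¹ * g t.1 y : EuclideanSpace ℂ Y) y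
        = w t.1 x * g t.1 y := fun t => by
      have h6 : ((√(μ t.1) : ℝ) : ℂ) ≠ 0 := by exact_mod_cast (hpos t).ne'
      simp only
      field_simp
    simp only [h7]
    rw [← Finset.sum_subtype (Finset.univ.filter fun a => μ a ≠ 0) (by simp)
      (fun a => w a x * g a y)]
    refine (Finset.sum_filter_of_ne fun a _ h => ?_).symm
    exact fun h8 => h (by rw [hz a h8]; simp)

/-! ### Multipartite systems -/

/-- The `n` subsystems have dimensions `d 0, …, d (n - 1)` and chosen orthonormal bases. `Cfg d I` labels
the product basis of the Hilbert space `H_I = ⨂_{i ∈ I} H_i`, where `H_i = ℂ ^ (d i)`. -/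
abbrev Cfg {n : ℕ} (d : Fin n → ℕ) (I : Finset (Fin n)) : Type :=
  ∀ i : {i : Fin n // i ∈ I}, Fin (d i)

/-- The Hilbert space `H_I = ⨂_{i ∈ I} H_i`, in coordinates for the product basis. -/
abbrev Hilb {n : ℕ} (d : Fin n → ℕ) (I : Finset (Fin n)) : Type :=
  EuclideanSpace ℂ (Cfg d I)

/-- Linear operators on `H_I`, as matrices in the product basis. -/
abbrev Op {n : ℕ} (d : Fin n → ℕ) (I : Finset (Fin n)) : Type :=
  Matrix (Cfg d I) (Cfg d I) ℂ

/-- Multi-indices of length `k`: the `k`-element subsets of the set of subsystems. -/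
abbrev MultiIndex (n k : ℕ) : Type := {I : Finset (Fin n) // I.card = k}

/-- Restriction of a basis label of `H_K` to the subsystems in `I ⊆ K`. -/
def Cfg.res {n : ℕ} {d : Fin n → ℕ} {I K : Finset (Fin n)} (h : I ⊆ K) (x : Cfg d K) : Cfg d I :=
  fun i => x ⟨i.1, h i.2⟩

/-- Basis labels of `H_I` and of `H_{Iᶜ}` together give a basis label of the full space. -/
def Cfg.glue {n : ℕ} {d : Fin n → ℕ} {I : Finset (Fin n)} (a : Cfg d I) (c : Cfg d Iᶜ) :
    Cfg d Finset.univ :=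
  fun i => if h : i.1 ∈ I then a ⟨i.1, h⟩ else c ⟨i.1, Finset.mem_compl.mpr h⟩

/-- A pure state: a unit vector of the full Hilbert space. -/
structure PureState {n : ℕ} (d : Fin n → ℕ) where
  vec : Hilb d Finset.univ
  norm_vec : ‖vec‖ = 1

/-- The density matrix `ρ = |ψ⟩⟨ψ|`. -/
def PureState.density {n : ℕ} {d : Fin n → ℕ} (ψ : PureState d) : Op d Finset.univ :=
  ketBra ψ.vec ψ.vec

/-- The partial trace over all the subsystems outside `I`. -/
def partialTrace {n : ℕ} {d : Fin n → ℕ} (I : Finset (Fin n)) (A : Op d Finset.univ) : Op d I :=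
  Matrix.of fun a b => ∑ c : Cfg d Iᶜ, A (Cfg.glue a c) (Cfg.glue b c)

/-- The reduced density matrix `ρ_I`. -/
def PureState.reduced {n : ℕ} {d : Fin n → ℕ} (ψ : PureState d) (I : Finset (Fin n)) : Op d I :=
  partialTrace I ψ.density

/-- The restriction `O|_ρ = s_ρ O s_ρ`. -/
def restrict {X : Type*} [Fintype X] [DecidableEq X] (ρ : Matrix X X ℂ) :
    Matrix X X ℂ →ₗ[ℂ] Matrix X X ℂ where
  toFun O := suppProj ρ * O * suppProj ρ
  map_add' A B := by rw [mul_add, add_mul]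
  map_smul' c A := by simp

/-- The space `Ω^k` of entanglement `k`-forms: tuples, indexed by the `k`-element sets `I`, of restricted
operators `O|_{ρ_I}`. For `k = 0` the only index is `∅`, `H_∅ = ℂ` and `ρ_∅ = 1`, so that `Ω^0 = ℂ`. -/
abbrev Form {n : ℕ} {d : Fin n → ℕ} (ψ : PureState d) (k : ℕ) : Type :=
  ∀ I : MultiIndex n k, LinearMap.range (restrict (ψ.reduced I.1))

/-- The signature of the permutation that sorts the concatenation of the increasing lists of the
elements of `I` and of `J` (for disjoint `I`, `J`): `-1` to the number of inversions. -/
def shuffleSign {n : ℕ} (I J : Finset (Fin n)) : ℂ :=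
  (-1) ^ ((I ×ˢ J).filter fun p => p.2 < p.1).card

/-- The shuffled tensor product of an operator on `H_I` and an operator on `H_J`: if `I` and `J` are
disjoint, it is the tensor product with the factors put in increasing order, as an operator on
`H_K` with `K = I ∪ J`, times the sign of the shuffle; otherwise it is zero. -/
def shuffleTensor {n : ℕ} {d : Fin n → ℕ} {I J K : Finset (Fin n)} (h : I ∪ J = K)
    (A : Op d I) (B : Op d J) : Op d K :=
  if Disjoint I J then
    shuffleSign I J • Matrix.of fun x y =>
      A (Cfg.res (h ▸ Finset.subset_union_left) x) (Cfg.res (h ▸ Finset.subset_union_left) y) *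
      B (Cfg.res (h ▸ Finset.subset_union_right) x) (Cfg.res (h ▸ Finset.subset_union_right) y)
  else 0

theorem shuffleTensor_add {n : ℕ} {d : Fin n → ℕ} {I J K : Finset (Fin n)} (h : I ∪ J = K)
    (A : Op d I) (B C : Op d J) :
    shuffleTensor h A (B + C) = shuffleTensor h A B + shuffleTensor h A C := by
  unfold shuffleTensor
  split_ifs
  · ext x y; simp [mul_add]
  · simp

theorem shuffleTensor_smul {n : ℕ} {d : Fin n → ℕ} {I J K : Finset (Fin n)} (h : I ∪ J = K)
    (A : Op d I) (c : ℂ) (B : Op d J) :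
    shuffleTensor h A (c • B) = c • shuffleTensor h A B := by
  unfold shuffleTensor
  split_ifs
  · ext x y; simp; ring
  · simp

theorem singleton_union_erase {n : ℕ} {K : Finset (Fin n)} {j : Fin n} (h : j ∈ K) :
    {j} ∪ K.erase j = K := by
  rw [← Finset.insert_eq, Finset.insert_erase h]

/-- The coboundary operator `d^k : Ω^k → Ω^(k+1)`, whose `K`-component is
`k ∑_{j ∈ K} (𝟙_j ⊗̂ ω_{K \ j}) |_{ρ_K}` for `k ≥ 1`; for `k = 0` the factor is `1`, which gives
`d^0 c = (c s_1, …, c s_n)`. For `k = n` the target is the zero space. -/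
def diff {n : ℕ} {d : Fin n → ℕ} (ψ : PureState d) (k : ℕ) :
    Form ψ k →ₗ[ℂ] Form ψ (k + 1) where
  toFun ω K := (restrict (ψ.reduced K.1)).rangeRestrict
    ((if k = 0 then 1 else k : ℂ) • ∑ j : {j : Fin n // j ∈ K.1},
      shuffleTensor (singleton_union_erase j.2) (1 : Op d {j.1})
        (ω ⟨K.1.erase j.1, by rw [Finset.card_erase_of_mem j.2, K.2, Nat.add_sub_cancel]⟩ : Op d _))
  map_add' ω η := by
    funext K
    simp only [Pi.add_apply, Submodule.coe_add, shuffleTensor_add, Finset.sum_add_distrib,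
      smul_add, map_add]
  map_smul' c ω := by
    funext K
    simp only [Pi.smul_apply, Submodule.coe_smul, shuffleTensor_smul, ← Finset.smul_sum,
      smul_comm _ c, map_smul, RingHom.id_apply]

/-- A Schmidt decomposition `ψ = ∑ α, λ_α |α_I⟩ ⊗ |α_J⟩` of a pure state along two complementary sets of
subsystems, with positive coefficients. -/
structure SchmidtDecomposition {n : ℕ} {d : Fin n → ℕ} (ψ : PureState d)
    (I J : Finset (Fin n)) where
  rank : ℕ
  coeff : Fin rank → ℝ
  coeff_pos : ∀ α, 0 < coeff α
  left : Fin rank → Hilb d I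
  right : Fin rank → Hilb d J
  orthonormal_left : Orthonormal ℂ left
  orthonormal_right : Orthonormal ℂ right
  expansion : ∀ x : Cfg d Finset.univ, ψ.vec x =
    ∑ α, (coeff α : ℂ) * left α (Cfg.res (Finset.subset_univ I) x) *
      right α (Cfg.res (Finset.subset_univ J) x)

def SchmidtDecomposition.swap {n : ℕ} {d : Fin n → ℕ} {ψ : PureState d}
    {I J : Finset (Fin n)} (S : SchmidtDecomposition ψ I J) : SchmidtDecomposition ψ J I where
  rank := S.rank
  coeff := S.coeff
  coeff_pos := S.coeff_pos
  left := S.right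
  right := S.left
  orthonormal_left := S.orthonormal_right
  orthonormal_right := S.orthonormal_left
  expansion x := by
    rw [S.expansion]
    exact Finset.sum_congr rfl fun α _ => by ring

theorem res_glue_left {n : ℕ} {d : Fin n → ℕ} {I : Finset (Fin n)} (a : Cfg d I) (c : Cfg d Iᶜ) :
    Cfg.res (Finset.subset_univ I) (Cfg.glue a c) = a := by
  funext i
  simp [Cfg.res, Cfg.glue, i.2]

theorem res_glue_right {n : ℕ} {d : Fin n → ℕ} {I : Finset (Fin n)} (a : Cfg d I)
    (c : Cfg d Iᶜ) : Cfg.res (Finset.subset_univ Iᶜ) (Cfg.glue a c) = c := by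
  funext i
  simp [Cfg.res, Cfg.glue, Finset.mem_compl.mp i.2]

theorem glue_res {n : ℕ} {d : Fin n → ℕ} {I : Finset (Fin n)} (x : Cfg d Finset.univ) :
    Cfg.glue (Cfg.res (Finset.subset_univ I) x) (Cfg.res (Finset.subset_univ Iᶜ) x) = x := by
  funext i
  unfold Cfg.glue Cfg.res
  split_ifs <;> rfl

def glueEquiv {n : ℕ} {d : Fin n → ℕ} (I : Finset (Fin n)) :
    Cfg d I × Cfg d Iᶜ ≃ Cfg d Finset.univ where
  toFun p := Cfg.glue p.1 p.2
  invFun x := (Cfg.res (Finset.subset_univ I) x, Cfg.res (Finset.subset_univ Iᶜ) x)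
  left_inv p := Prod.ext (res_glue_left p.1 p.2) (res_glue_right p.1 p.2)
  right_inv x := glue_res x

/-- Schmidt decompositions exist. -/
theorem nonempty_schmidt {n : ℕ} {d : Fin n → ℕ} (ψ : PureState d) {I J : Finset (Fin n)}
    (h : J = Iᶜ) : Nonempty (SchmidtDecomposition ψ I J) := by
  subst h
  obtain ⟨r, c, u, v, hc, hu, hv, hM⟩ :=
    exists_svd (Matrix.of fun (a : Cfg d I) (b : Cfg d Iᶜ) => ψ.vec (Cfg.glue a b))
  refine ⟨⟨r, c, hc, u, v, hu, hv, fun x => ?_⟩⟩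
  rw [← hM, Matrix.of_apply, glue_res]

theorem reduced_left {n : ℕ} {d : Fin n → ℕ} {ψ : PureState d} {I J : Finset (Fin n)}
    (h : J = Iᶜ) (S : SchmidtDecomposition ψ I J) :
    ψ.reduced I = ∑ α, ((S.coeff α : ℂ) ^ 2) • ketBra (S.left α) (S.left α) := by
  subst h
  ext a b
  have hv : ∀ α β, ∑ c, S.right α c * star (S.right β c) = if β = α then 1 else 0 := by
    intro α β
    rw [← orthonormal_iff_ite.mp S.orthonormal_right β α, PiLp.inner_apply]
    rfl
  simp only [PureState.reduced, partialTrace, PureState.density, ketBra, Matrix.of_apply,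
    Matrix.vecMulVec_apply, Pi.star_apply, S.expansion, res_glue_left, res_glue_right,
    Matrix.sum_apply, Matrix.smul_apply, star_sum, star_mul', smul_eq_mul]
  have hs : ∀ α, star (S.coeff α : ℂ) = S.coeff α := fun α => Complex.conj_ofReal _
  simp only [hs, Finset.sum_mul_sum]
  rw [Finset.sum_comm]
  refine Finset.sum_congr rfl fun α _ => ?_
  rw [Finset.sum_comm]
  have : ∀ β, ∑ c, (S.coeff α : ℂ) * S.left α a * S.right α c *
      (S.coeff β * star (S.left β b) * star (S.right β c)) =
      S.coeff α * S.left α a * (S.coeff β * star (S.left β b)) *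
        ∑ c, S.right α c * star (S.right β c) := by
    intro β
    rw [Finset.mul_sum]
    exact Finset.sum_congr rfl fun c _ => by ring
  simp only [this, hv, mul_ite, mul_one, mul_zero, Finset.sum_ite_eq', Finset.mem_univ, if_true]
  ring

theorem suppProj_left {n : ℕ} {d : Fin n → ℕ} {ψ : PureState d} {I J : Finset (Fin n)}
    (h : J = Iᶜ) (S : SchmidtDecomposition ψ I J) :
    suppProj (ψ.reduced I) = ∑ α, ketBra (S.left α) (S.left α) := by
  rw [reduced_left h S]
  exact suppProj_spectral _ S.orthonormal_left _ fun α =>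
    pow_ne_zero _ (by exact_mod_cast (S.coeff_pos α).ne')

theorem sandwich {X : Type*} [Fintype X] [DecidableEq X] {r : ℕ}
    (u : Fin r → EuclideanSpace ℂ X) (A : Matrix X X ℂ) :
    (∑ α, ketBra (u α) (u α)) * A * (∑ β, ketBra (u β) (u β)) =
      ∑ α, ∑ β, matElem (u α) A (u β) • ketBra (u α) (u β) := by
  simp only [Finset.sum_mul, Finset.mul_sum]
  rw [Finset.sum_comm]
  refine Finset.sum_congr rfl fun α _ => Finset.sum_congr rfl fun β _ => ?_
  simp only [ketBra, matElem]
  rw [Matrix.vecMulVec_mul, Matrix.vecMulVec_mul_vecMulVec, Matrix.dotProduct_mulVec,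
    Matrix.vecMulVec_smul]

theorem matElem_sum_ketBra {X : Type*} [Fintype X] {r : ℕ}
    {u : Fin r → EuclideanSpace ℂ X} (hu : Orthonormal ℂ u) (f : Fin r → Fin r → ℂ)
    (γ δ : Fin r) :
    matElem (u γ) (∑ α, ∑ β, f α β • ketBra (u α) (u β)) (u δ) = f γ δ := by
  have h1 : ∀ α β, star (u α).ofLp ⬝ᵥ (u β).ofLp = if α = β then 1 else 0 := by
    intro α β
    rw [← orthonormal_iff_ite.mp hu α β, PiLp.inner_apply]
    simp only [dotProduct, RCLike.inner_apply, starRingEnd_apply, Pi.star_apply, mul_comm]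
  simp only [matElem, ketBra, Matrix.sum_mulVec, dotProduct_sum, Matrix.smul_mulVec,
    dotProduct_smul, Matrix.vecMulVec_mulVec, h1]
  simp

theorem mem_range_restrict {n : ℕ} {d : Fin n → ℕ} {ψ : PureState d} {I J : Finset (Fin n)}
    (h : J = Iᶜ) (S : SchmidtDecomposition ψ I J) (f : Fin S.rank → Fin S.rank → ℂ) :
    ∑ α, ∑ β, f α β • ketBra (S.left α) (S.left β) ∈
      LinearMap.range (restrict (ψ.reduced I)) := by
  refine ⟨∑ α, ∑ β, f α β • ketBra (S.left α) (S.left β), ?_⟩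
  change suppProj (ψ.reduced I) * _ * suppProj (ψ.reduced I) = _
  rw [suppProj_left h S, sandwich]
  simp only [matElem_sum_ketBra S.orthonormal_left]

theorem card_compl_eq {n k : ℕ} (hk : k ≤ n) (J : MultiIndex n (n - k)) : (J.1)ᶜ.card = k := by
  rw [Finset.card_compl, J.2, Fintype.card_fin, Nat.sub_sub_self hk]

/-- The Hodge star with respect to a given family of Schmidt decompositions:
`(∗ω)_J = ∑ α β, (-1)^σ conj((ω_I)_{αβ}) |α_J⟩⟨β_J|` with `I = Jᶜ`, where `σ` sorts `(I, J)`. It is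
conjugate-linear. -/
def hodgeStarOf {n : ℕ} {d : Fin n → ℕ} (ψ : PureState d)
    (S : ∀ J : Finset (Fin n), SchmidtDecomposition ψ Jᶜ J) {k : ℕ} (hk : k ≤ n) :
    Form ψ k →ₛₗ[starRingEnd ℂ] Form ψ (n - k) where
  toFun ω J :=
    ⟨∑ α, ∑ β, (shuffleSign (J.1)ᶜ J.1 *
        starRingEnd ℂ (matElem ((S J.1).left α) (ω ⟨(J.1)ᶜ, card_compl_eq hk J⟩ : Op d _)
          ((S J.1).left β))) • ketBra ((S J.1).right α) ((S J.1).right β),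
      mem_range_restrict rfl (S J.1).swap _⟩
  map_add' ω η := by
    funext J
    apply Subtype.ext
    simp [matElem, Matrix.add_mulVec, mul_add, add_smul, Finset.sum_add_distrib]
  map_smul' c ω := by
    funext J
    apply Subtype.ext
    simp only [matElem, Pi.smul_apply, Submodule.coe_smul, Matrix.smul_mulVec, dotProduct_smul,
      smul_eq_mul, map_mul, Finset.smul_sum, smul_smul]
    refine Finset.sum_congr rfl fun α _ => Finset.sum_congr rfl fun β _ => ?_
    rw [mul_left_comm]

/-- A choice of Schmidt decompositions. -/
def schmidt {n : ℕ} {d : Fin n → ℕ} (ψ : PureState d) (J : Finset (Fin n)) :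
    SchmidtDecomposition ψ Jᶜ J :=
  Classical.choice (nonempty_schmidt ψ (compl_compl J).symm)

/-- The Hodge star `∗ : Ω^k → Ω^(n-k)`, through a choice of Schmidt decompositions. -/
def hodgeStar {n : ℕ} {d : Fin n → ℕ} (ψ : PureState d) {k : ℕ} (hk : k ≤ n) :
    Form ψ k →ₛₗ[starRingEnd ℂ] Form ψ (n - k) :=
  hodgeStarOf ψ (schmidt ψ) hk

/-- The wedge product of entanglement forms. -/
def wedge {n : ℕ} {d : Fin n → ℕ} {ψ : PureState d} {p q : ℕ} (ω : Form ψ p) (η : Form ψ q) :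
    Form ψ (p + q) :=
  fun K => (restrict (ψ.reduced K.1)).rangeRestrict
    (∑ I : MultiIndex n p, ∑ J : MultiIndex n q,
      if h : I.1 ∪ J.1 = K.1 then shuffleTensor h (ω I : Op d _) (η J : Op d _) else 0)

/-- The inner product `⟨ω, η⟩ = tr (ω ∧ ∗η)|_ρ`, linear in `ω` and conjugate-linear in `η`; the trace is
that of the component of the `n`-form `ω ∧ ∗η` on the full Hilbert space. -/
def hodgeInner {n : ℕ} {d : Fin n → ℕ} {ψ : PureState d} {k : ℕ} (hk : k ≤ n)
    (ω η : Form ψ k) : ℂ :=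
  Matrix.trace (wedge ω (hodgeStar ψ hk η)
    ⟨Finset.univ, by rw [Finset.card_univ, Fintype.card_fin, Nat.add_sub_of_le hk]⟩ :
      Op d Finset.univ)

theorem reduced_univ {n : ℕ} {d : Fin n → ℕ} (ψ : PureState d) :
    ψ.reduced Finset.univ = ketBra ψ.vec ψ.vec := by
  ext a b
  have : IsEmpty {i : Fin n // i ∈ (Finset.univ : Finset (Fin n))ᶜ} := ⟨fun i => by
    simpa using i.2⟩
  have hg : ∀ (a : Cfg d Finset.univ) (c : Cfg d (Finset.univ : Finset (Fin n))ᶜ),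
      Cfg.glue a c = a := by
    intro a c; funext i; simp [Cfg.glue]
  simp only [PureState.reduced, partialTrace, PureState.density, Matrix.of_apply, hg,
    Finset.sum_const, Finset.card_univ]
  rw [Fintype.card_eq_one_iff_nonempty_unique.mpr ⟨Pi.uniqueOfIsEmpty _⟩, one_smul]

theorem inner_vec {n : ℕ} {d : Fin n → ℕ} (ψ : PureState d) :
    inner ℂ ψ.vec ψ.vec = (1 : ℂ) := by
  rw [inner_self_eq_norm_sq_to_K, ψ.norm_vec]; simp

theorem trace_restrict_univ {n : ℕ} {d : Fin n → ℕ} (ψ : PureState d) (A : Op d Finset.univ) :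
    Matrix.trace (restrict (ψ.reduced Finset.univ) A) = matElem ψ.vec A ψ.vec := by
  have hm : ketBra ψ.vec ψ.vec * ketBra ψ.vec ψ.vec = ketBra ψ.vec ψ.vec := by
    rw [ketBra_mul, inner_vec, one_smul]
  have hs : suppProj (ψ.reduced Finset.univ) = ketBra ψ.vec ψ.vec := by
    rw [reduced_univ]
    refine suppProj_eq (Y := ketBra ψ.vec ψ.vec) ?_ hm hm hm
    ext i j
    simp [ketBra, Matrix.vecMulVec_apply, mul_comm]
  change Matrix.trace (suppProj (ψ.reduced Finset.univ) * A * suppProj (ψ.reduced Finset.univ)) = _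
  rw [hs, Matrix.trace_mul_comm, ← mul_assoc, hm, ketBra, Matrix.trace_mul_comm,
    Matrix.mul_vecMulVec, Matrix.trace_vecMulVec, dotProduct_comm]
  rfl

theorem sum_prod_factor {X Y : Type*} [Fintype X] [Fintype Y] (F : X → X → ℂ) (G : Y → Y → ℂ) :
    ∑ p : X × Y, ∑ q : X × Y, F p.1 q.1 * G p.2 q.2 =
      (∑ a, ∑ a', F a a') * ∑ b, ∑ b', G b b' := by
  have h : ∀ p : X × Y, ∑ q : X × Y, F p.1 q.1 * G p.2 q.2 =
      (∑ a', F p.1 a') * ∑ b', G p.2 b' := by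
    intro p
    rw [Fintype.sum_prod_type, Finset.sum_mul_sum]
  simp only [h]
  rw [Fintype.sum_prod_type, Finset.sum_mul_sum]

theorem sum_swap {X Y : Type*} [Fintype X] [Fintype Y] (t : Y → Y → X → X → ℂ) :
    ∑ p, ∑ q, ∑ α, ∑ β, t α β p q = ∑ α, ∑ β, ∑ p, ∑ q, t α β p q := by
  calc ∑ p, ∑ q, ∑ α, ∑ β, t α β p q = ∑ p, ∑ α, ∑ q, ∑ β, t α β p q :=
        Finset.sum_congr rfl fun p _ => Finset.sum_comm
    _ = ∑ α, ∑ p, ∑ q, ∑ β, t α β p q := Finset.sum_comm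
    _ = ∑ α, ∑ p, ∑ β, ∑ q, t α β p q :=
        Finset.sum_congr rfl fun α _ => Finset.sum_congr rfl fun p _ => Finset.sum_comm
    _ = ∑ α, ∑ β, ∑ p, ∑ q, t α β p q := Finset.sum_congr rfl fun α _ => Finset.sum_comm

theorem matElem_shuffleTensor {n : ℕ} {d : Fin n → ℕ} {ψ : PureState d}
    {I J : Finset (Fin n)} (hJ : J = Iᶜ) (h : I ∪ J = Finset.univ)
    (S : SchmidtDecomposition ψ I J) (A : Op d I) (B : Op d J) :
    matElem ψ.vec (shuffleTensor h A B) ψ.vec =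
      shuffleSign I J * ∑ α, ∑ β, (S.coeff α : ℂ) * S.coeff β *
        (matElem (S.left α) A (S.left β) * matElem (S.right α) B (S.right β)) := by
  subst hJ
  have hs : ∀ α, star (S.coeff α : ℂ) = S.coeff α := fun α => Complex.conj_ofReal _
  have e1 : matElem ψ.vec (shuffleTensor h A B) ψ.vec = shuffleSign I Iᶜ *
      ∑ p : Cfg d I × Cfg d Iᶜ, ∑ q : Cfg d I × Cfg d Iᶜ,
        star (ψ.vec (Cfg.glue p.1 p.2)) * (A p.1 q.1 * B p.2 q.2) *
          ψ.vec (Cfg.glue q.1 q.2) := by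
    unfold shuffleTensor
    rw [if_pos disjoint_compl_right]
    simp only [matElem, Matrix.smul_mulVec, dotProduct_smul, smul_eq_mul]
    congr 1
    simp only [dotProduct, Matrix.mulVec, Finset.mul_sum]
    rw [← (glueEquiv I).sum_comp]
    refine Finset.sum_congr rfl fun p _ => ?_
    rw [← (glueEquiv I).sum_comp]
    refine Finset.sum_congr rfl fun q _ => ?_
    simp only [glueEquiv, Equiv.coe_fn_mk, Matrix.of_apply, res_glue_left, res_glue_right,
      Pi.star_apply]
    ring
  rw [e1]
  congr 1
  simp only [S.expansion, res_glue_left, res_glue_right, star_sum, star_mul', hs]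
  have e2 : ∀ α β, (S.coeff α : ℂ) * S.coeff β *
        (matElem (S.left α) A (S.left β) * matElem (S.right α) B (S.right β)) =
      ∑ p : Cfg d I × Cfg d Iᶜ, ∑ q : Cfg d I × Cfg d Iᶜ,
        (S.coeff α * star (S.left α p.1) * star (S.right α p.2)) * (A p.1 q.1 * B p.2 q.2) *
          (S.coeff β * S.left β q.1 * S.right β q.2) := by
    intro α β
    have hL : matElem (S.left α) A (S.left β) =
        ∑ a, ∑ a', star (S.left α a) * A a a' * S.left β a' := by
      simp only [matElem, dotProduct, Matrix.mulVec, Finset.mul_sum, Pi.star_apply, mul_assoc]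
    have hR : matElem (S.right α) B (S.right β) =
        ∑ b, ∑ b', star (S.right α b) * B b b' * S.right β b' := by
      simp only [matElem, dotProduct, Matrix.mulVec, Finset.mul_sum, Pi.star_apply, mul_assoc]
    rw [hL, hR, ← sum_prod_factor, Finset.mul_sum]
    refine Finset.sum_congr rfl fun p _ => ?_
    rw [Finset.mul_sum]
    refine Finset.sum_congr rfl fun q _ => ?_
    ring
  simp only [e2]
  rw [← sum_swap]
  refine Finset.sum_congr rfl fun p _ => Finset.sum_congr rfl fun q _ => ?_
  rw [Finset.sum_mul, Finset.sum_mul_sum]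

theorem shuffleSign_mul_self {n : ℕ} (I J : Finset (Fin n)) :
    shuffleSign I J * shuffleSign I J = 1 := by
  rw [shuffleSign, ← mul_pow]; simp

/-- The inner product in terms of Schmidt coefficients; it shows positive definiteness. -/
theorem hodgeInner_eq {n : ℕ} {d : Fin n → ℕ} {ψ : PureState d} {k : ℕ} (hk : k ≤ n)
    (ω η : Form ψ k) :
    hodgeInner hk ω η = ∑ J : MultiIndex n (n - k), ∑ α, ∑ β,
      ((schmidt ψ J.1).coeff α : ℂ) * (schmidt ψ J.1).coeff β *
        (matElem ((schmidt ψ J.1).left α) (ω ⟨(J.1)ᶜ, card_compl_eq hk J⟩ : Op d _)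
            ((schmidt ψ J.1).left β) *
          starRingEnd ℂ (matElem ((schmidt ψ J.1).left α)
            (η ⟨(J.1)ᶜ, card_compl_eq hk J⟩ : Op d _) ((schmidt ψ J.1).left β))) := by
  have h0 : hodgeInner hk ω η = matElem ψ.vec
      (∑ I : MultiIndex n k, ∑ J : MultiIndex n (n - k),
        if h : I.1 ∪ J.1 = Finset.univ then
          shuffleTensor h (ω I : Op d _) (hodgeStar ψ hk η J : Op d _) else 0) ψ.vec :=
    trace_restrict_univ ψ _
  have hadd : ∀ (T : Type) [Fintype T] (f : T → Op d Finset.univ),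
      matElem ψ.vec (∑ t, f t) ψ.vec = ∑ t, matElem ψ.vec (f t) ψ.vec := by
    intro T _ f
    simp only [matElem, Matrix.sum_mulVec, dotProduct_sum]
  rw [h0, Finset.sum_comm, hadd]
  refine Finset.sum_congr rfl fun J _ => ?_
  rw [hadd, Finset.sum_eq_single ⟨(J.1)ᶜ, card_compl_eq hk J⟩]
  · have hu : (J.1)ᶜ ∪ J.1 = Finset.univ := by
      rw [Finset.union_comm, Finset.union_compl]
    rw [dif_pos hu, matElem_shuffleTensor (compl_compl J.1).symm hu (schmidt ψ J.1),
      Finset.mul_sum]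
    refine Finset.sum_congr rfl fun α _ => ?_
    rw [Finset.mul_sum]
    refine Finset.sum_congr rfl fun β _ => ?_
    have hst : matElem ((schmidt ψ J.1).right α) (hodgeStar ψ hk η J : Op d _)
        ((schmidt ψ J.1).right β) = shuffleSign (J.1)ᶜ J.1 *
          starRingEnd ℂ (matElem ((schmidt ψ J.1).left α)
            (η ⟨(J.1)ᶜ, card_compl_eq hk J⟩ : Op d _) ((schmidt ψ J.1).left β)) :=
      matElem_sum_ketBra (schmidt ψ J.1).orthonormal_right _ α β
    rw [hst]
    linear_combination ((schmidt ψ J.1).coeff α : ℂ) * (schmidt ψ J.1).coeff β *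
        (matElem ((schmidt ψ J.1).left α) (ω ⟨(J.1)ᶜ, card_compl_eq hk J⟩ : Op d _)
            ((schmidt ψ J.1).left β) *
          starRingEnd ℂ (matElem ((schmidt ψ J.1).left α)
            (η ⟨(J.1)ᶜ, card_compl_eq hk J⟩ : Op d _) ((schmidt ψ J.1).left β))) *
        shuffleSign_mul_self (J.1)ᶜ J.1
  · intro I _ hI
    rw [dif_neg]
    · simp [matElem]
    · intro h
      apply hI
      apply Subtype.ext
      refine (Finset.eq_of_subset_of_card_le ?_ ?_).symm
      · intro x hx
        have := h ▸ Finset.mem_univ x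
        rcases Finset.mem_union.mp this with h' | h'
        · exact h'
        · exact absurd h' (Finset.mem_compl.mp hx)
      · rw [I.2, card_compl_eq hk J]
  · intro h; exact absurd (Finset.mem_univ _) h

theorem matElem_add {X : Type*} [Fintype X] (u v : EuclideanSpace ℂ X) (A B : Matrix X X ℂ) :
    matElem u (A + B) v = matElem u A v + matElem u B v := by
  simp [matElem, Matrix.add_mulVec]

theorem matElem_smul {X : Type*} [Fintype X] (u v : EuclideanSpace ℂ X) (c : ℂ)
    (A : Matrix X X ℂ) : matElem u (c • A) v = c * matElem u A v := by
  simp [matElem, Matrix.smul_mulVec]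

theorem form_eq_zero {n : ℕ} {d : Fin n → ℕ} {ψ : PureState d} {k : ℕ} (hk : k ≤ n)
    (ω : Form ψ k)
    (h : ∀ (J : MultiIndex n (n - k)) (α β), matElem ((schmidt ψ J.1).left α)
      (ω ⟨(J.1)ᶜ, card_compl_eq hk J⟩ : Op d _) ((schmidt ψ J.1).left β) = 0) : ω = 0 := by
  funext I
  obtain ⟨J, rfl⟩ : ∃ J : MultiIndex n (n - k), I = ⟨(J.1)ᶜ, card_compl_eq hk J⟩ :=
    ⟨⟨(I.1)ᶜ, by rw [Finset.card_compl, I.2, Fintype.card_fin]⟩,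
      Subtype.ext (compl_compl I.1).symm⟩
  apply Subtype.ext
  obtain ⟨A, hA⟩ := (ω ⟨(J.1)ᶜ, card_compl_eq hk J⟩).2
  have hs := suppProj_left (compl_compl J.1).symm (schmidt ψ J.1)
  have hi : (∑ α, ketBra ((schmidt ψ J.1).left α) ((schmidt ψ J.1).left α)) *
      (∑ α, ketBra ((schmidt ψ J.1).left α) ((schmidt ψ J.1).left α)) =
      ∑ α, ketBra ((schmidt ψ J.1).left α) ((schmidt ψ J.1).left α) := by
    simp only [Finset.sum_mul, Finset.mul_sum, ketBra_mul,
      orthonormal_iff_ite.mp (schmidt ψ J.1).orthonormal_left]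
    simp
  have h2 := sandwich (schmidt ψ J.1).left (ω ⟨(J.1)ᶜ, card_compl_eq hk J⟩ : Op d _)
  simp only [h, zero_smul, Finset.sum_const_zero] at h2
  change suppProj (ψ.reduced (J.1)ᶜ) * A * suppProj (ψ.reduced (J.1)ᶜ) = _ at hA
  rw [hs] at hA
  rw [← hA] at h2
  rw [← hA]
  refine Eq.trans ?_ h2
  conv_lhs => rw [← hi]
  simp only [mul_assoc]

/-- The inner product space structure of `Ω^k` (Mathlib's convention is linearity in the second
argument, hence the swap). -/
@[reducible] def innerCore {n : ℕ} {d : Fin n → ℕ} (ψ : PureState d) {k : ℕ} (hk : k ≤ n) :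
    InnerProductSpace.Core ℂ (Form ψ k) where
  inner ω η := hodgeInner hk η ω
  conj_inner_symm ω η := by
    simp only [hodgeInner_eq, map_sum, map_mul, Complex.conj_conj, Complex.conj_ofReal]
    refine Finset.sum_congr rfl fun J _ => Finset.sum_congr rfl fun α _ =>
      Finset.sum_congr rfl fun β _ => ?_
    ring
  re_inner_nonneg ω := by
    simp only [hodgeInner_eq, map_sum]
    refine Finset.sum_nonneg fun J _ => Finset.sum_nonneg fun α _ =>
      Finset.sum_nonneg fun β _ => ?_
    rw [Complex.mul_conj, ← Complex.ofReal_mul, ← Complex.ofReal_mul]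
    exact mul_nonneg (mul_nonneg ((schmidt ψ J.1).coeff_pos α).le ((schmidt ψ J.1).coeff_pos β).le)
      (Complex.normSq_nonneg _)
  add_left ω η ξ := by
    simp only [hodgeInner_eq, Pi.add_apply, Submodule.coe_add, matElem_add, map_add, mul_add,
      Finset.sum_add_distrib]
  smul_left ω η c := by
    simp only [hodgeInner_eq, Pi.smul_apply, Submodule.coe_smul, matElem_smul, map_mul,
      Finset.mul_sum]
    refine Finset.sum_congr rfl fun J _ => Finset.sum_congr rfl fun α _ =>
      Finset.sum_congr rfl fun β _ => ?_
    ring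
  definite ω h := by
    apply form_eq_zero hk
    rw [hodgeInner_eq] at h
    simp only [Complex.mul_conj, ← Complex.ofReal_mul, ← Complex.ofReal_sum] at h
    have h' := Complex.ofReal_eq_zero.mp h
    have p : ∀ (J : MultiIndex n (n - k)) (α β), 0 ≤ (schmidt ψ J.1).coeff α *
        (schmidt ψ J.1).coeff β * Complex.normSq (matElem ((schmidt ψ J.1).left α)
      (ω ⟨(J.1)ᶜ, card_compl_eq hk J⟩ : Op d _) ((schmidt ψ J.1).left β)) := fun J α β =>
      mul_nonneg (mul_nonneg ((schmidt ψ J.1).coeff_pos α).le ((schmidt ψ J.1).coeff_pos β).le)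
      (Complex.normSq_nonneg _)
    intro J α β
    rw [Finset.sum_eq_zero_iff_of_nonneg fun J _ => Finset.sum_nonneg fun α _ =>
      Finset.sum_nonneg fun β _ => p J α β] at h'
    have h1 := h' J (Finset.mem_univ _)
    rw [Finset.sum_eq_zero_iff_of_nonneg fun α _ => Finset.sum_nonneg fun β _ => p J α β] at h1
    have h2 := h1 α (Finset.mem_univ _)
    rw [Finset.sum_eq_zero_iff_of_nonneg fun β _ => p J α β] at h2
    have h3 := h2 β (Finset.mem_univ _)
    rcases mul_eq_zero.mp h3 with h4 | h4
    · exact absurd h4 (mul_pos ((schmidt ψ J.1).coeff_pos α) ((schmidt ψ J.1).coeff_pos β)).ne'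
    · exact Complex.normSq_eq_zero.mp h4

/-- The coboundary operator has exactly one adjoint for the inner products `hodgeInner`. -/
theorem exists_codiff {n : ℕ} {d : Fin n → ℕ} (ψ : PureState d) {k : ℕ} (hk : k + 1 ≤ n) :
    ∃! δ : Form ψ (k + 1) →ₗ[ℂ] Form ψ k, ∀ (ω : Form ψ (k + 1)) (η : Form ψ k),
      hodgeInner hk ω (diff ψ k η) = hodgeInner (Nat.le_of_succ_le hk) (δ ω) η := by
  let c1 : InnerProductSpace.Core ℂ (Form ψ k) := innerCore ψ (Nat.le_of_succ_le hk)
  let n1 : NormedAddCommGroup (Form ψ k) := c1.toNormedAddCommGroup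
  let i1 : InnerProductSpace ℂ (Form ψ k) := InnerProductSpace.ofCore c1.toCore
  let c2 : InnerProductSpace.Core ℂ (Form ψ (k + 1)) := innerCore ψ hk
  let n2 : NormedAddCommGroup (Form ψ (k + 1)) := c2.toNormedAddCommGroup
  let i2 : InnerProductSpace ℂ (Form ψ (k + 1)) := InnerProductSpace.ofCore c2.toCore
  refine ⟨LinearMap.adjoint (diff ψ k), fun ω η => ?_, fun δ hδ => ?_⟩
  · exact (LinearMap.adjoint_inner_right (diff ψ k) η ω).symm
  · rw [LinearMap.eq_adjoint_iff]
    intro ω η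
    have h := congrArg (starRingEnd ℂ) (hδ ω η)
    have e1 : ∀ a b : Form ψ k, inner ℂ a b = hodgeInner (Nat.le_of_succ_le hk) b a :=
      fun a b => rfl
    have e2 : ∀ a b : Form ψ (k + 1), inner ℂ a b = hodgeInner hk b a := fun a b => rfl
    rw [← e1, ← e2, inner_conj_symm, inner_conj_symm] at h
    exact h.symm

/-- The codifferential `δ : Ω^(k+1) → Ω^k`: the linear map with `⟨ω, dη⟩ = ⟨δω, η⟩`. -/
def codiff {n : ℕ} {d : Fin n → ℕ} (ψ : PureState d) {k : ℕ} (hk : k + 1 ≤ n) :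
    Form ψ (k + 1) →ₗ[ℂ] Form ψ k :=
  (exists_codiff ψ hk).choose

/-- The space of harmonic `k`-forms: those annihilated by `d` and by `δ` (where `δ = 0` on `Ω^0`). -/
def harmonic {n : ℕ} {d : Fin n → ℕ} (ψ : PureState d) :
    (k : ℕ) → k ≤ n → Submodule ℂ (Form ψ k)
  | 0, _ => LinearMap.ker (diff ψ 0)
  | k + 1, hk => LinearMap.ker (diff ψ (k + 1)) ⊓ LinearMap.ker (codiff ψ hk)

end

end EntanglementHodge

namespace EntanglementHodge

noncomputable section

/-! Hodge duality holds because a form is harmonic exactly when both it and its star are closed, a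
condition that the star exchanges with itself. Three facts carry this.

The star is canonical and almost an involution. Overlaps between two Schmidt bases on one side are
the conjugates of the overlaps on the other side (`inner_right_eq_inner_left`), so conjugating
matrix elements makes the operator independent of the basis. Reversing a Schmidt decomposition then
gives `**ω = (-1)^(k(n-k)) ω` (`hodgeStar_hodgeStar`), hence bijectivity.

The operator `d` is its own transpose, up to a nonzero factor, for the bilinear pairing `tr (ω ∧
ζ)|_ρ` (`pairing_diff`). Both `dη ∧ ζ` and `η ∧ dζ` expand into expectation values of `𝟙_j ⊗ η_A ⊗
ζ_B` over partitions `{j} ⊔ A ⊔ B` of all subsystems. Restriction to supports is invisible between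
two copies of `ψ`, and the signs differ by `(-1)^p` throughout. The factors `c_k` only need to be
nonzero.

Since `⟨ω, η⟩` is the pairing of `ω` with `*η`, moving `d` across gives `δω = 0 ↔ d*ω = 0`
(`codiff_eq_zero_iff`); nondegeneracy of the pairing comes from definiteness of the inner product
and surjectivity of the star. The linear isomorphism is then a dimension count, because the star
itself is only conjugate-linear. -/

/-! ### Shuffle signs -/

theorem shuffleSign_union_left {n : ℕ} {I J : Finset (Fin n)} (h : Disjoint I J)
    (K : Finset (Fin n)) : shuffleSign (I ∪ J) K = shuffleSign I K * shuffleSign J K := by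
  unfold shuffleSign
  rw [← pow_add, Finset.union_product, Finset.filter_union, Finset.card_union_of_disjoint]
  exact Finset.disjoint_filter_filter (Finset.disjoint_product.mpr (Or.inl h))

theorem shuffleSign_union_right {n : ℕ} (I : Finset (Fin n)) {J K : Finset (Fin n)}
    (h : Disjoint J K) : shuffleSign I (J ∪ K) = shuffleSign I J * shuffleSign I K := by
  unfold shuffleSign
  rw [← pow_add, Finset.product_union, Finset.filter_union, Finset.card_union_of_disjoint]
  exact Finset.disjoint_filter_filter (Finset.disjoint_product.mpr (Or.inr h))

/-- By disjointness, each pair in `I × J` is an inversion for exactly one of the two orders of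
concatenation. -/
theorem shuffleSign_mul_swap {n : ℕ} {I J : Finset (Fin n)} (h : Disjoint I J) :
    shuffleSign I J * shuffleSign J I = (-1) ^ (I.card * J.card) := by
  unfold shuffleSign
  have e : ((J ×ˢ I).filter fun p => p.2 < p.1).card =
      ((I ×ˢ J).filter fun p => ¬ p.2 < p.1).card := by
    refine Finset.card_bij' (fun p _ => p.swap) (fun p _ => p.swap) ?_ ?_ ?_ ?_
    · rintro ⟨a, b⟩ hp
      simp only [Finset.mem_filter, Finset.mem_product, Prod.swap] at hp ⊢
      exact ⟨hp.1.symm, not_lt.mpr hp.2.le⟩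
    · rintro ⟨a, b⟩ hp
      simp only [Finset.mem_filter, Finset.mem_product, Prod.swap] at hp ⊢
      refine ⟨hp.1.symm, lt_of_le_of_ne (not_lt.mp hp.2) fun hab => ?_⟩
      exact Finset.disjoint_left.mp h hp.1.1 (hab ▸ hp.1.2)
    · intros; rfl
    · intros; rfl
  rw [← pow_add, e, Finset.card_filter_add_card_filter_not, Finset.card_product]

/-- The sign with which the coboundary operator moves across the wedge product. -/
theorem shuffleSign_singleton_comm {n : ℕ} {j : Fin n} {A B : Finset (Fin n)} (hA : j ∉ A)
    (hB : j ∉ B) :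
    shuffleSign ({j} ∪ A) B * shuffleSign {j} A =
      (-1) ^ A.card * (shuffleSign A ({j} ∪ B) * shuffleSign {j} B) := by
  have hjA : Disjoint {j} A := Finset.disjoint_singleton_left.mpr hA
  have h1 := shuffleSign_mul_swap hjA
  rw [Finset.card_singleton, one_mul] at h1
  rw [shuffleSign_union_left hjA,
    shuffleSign_union_right A (Finset.disjoint_singleton_left.mpr hB), ← h1]
  -- With `(-1) ^ A.card` written as the product of the two signs of `{j}` and `A`, the sides differ
  -- only by the square of the sign of `(A, {j})`.
  linear_combination (-(shuffleSign {j} B * shuffleSign A B * shuffleSign {j} A)) *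
    shuffleSign_mul_self A {j}

/-! ### Comparison of Schmidt decompositions -/

section Schmidt

variable {n : ℕ} {d : Fin n → ℕ} {ψ : PureState d} {I J : Finset (Fin n)}

/-- A restricted operator is determined by its matrix elements in a Schmidt basis. -/
theorem eq_sum_ketBra (h : J = Iᶜ) (S : SchmidtDecomposition ψ I J) {A : Op d I}
    (hA : A ∈ LinearMap.range (restrict (ψ.reduced I))) :
    A = ∑ α, ∑ β, matElem (S.left α) A (S.left β) • ketBra (S.left α) (S.left β) := by
  obtain ⟨B, rfl⟩ := hA
  have hB : restrict (ψ.reduced I) B =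
      ∑ α, ∑ β, matElem (S.left α) B (S.left β) • ketBra (S.left α) (S.left β) := by
    change suppProj (ψ.reduced I) * B * suppProj (ψ.reduced I) = _
    rw [suppProj_left h S, sandwich]
  rw [hB]
  simp only [matElem_sum_ketBra S.orthonormal_left]

/-- Restriction does not change the matrix elements in a Schmidt basis. -/
theorem matElem_restrict (h : J = Iᶜ) (S : SchmidtDecomposition ψ I J) (A : Op d I)
    (α β : Fin S.rank) :
    matElem (S.left α) (restrict (ψ.reduced I) A) (S.left β) =
      matElem (S.left α) A (S.left β) := by
  have hB : restrict (ψ.reduced I) A =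
      ∑ α, ∑ β, matElem (S.left α) A (S.left β) • ketBra (S.left α) (S.left β) := by
    change suppProj (ψ.reduced I) * A * suppProj (ψ.reduced I) = _
    rw [suppProj_left h S, sandwich]
  rw [hB, matElem_sum_ketBra S.orthonormal_left]

/-- Contracting the left factor of the state with Schmidt vectors of two decompositions. -/
theorem coeff_mul_inner (h : J = Iᶜ) (S T : SchmidtDecomposition ψ I J) (α : Fin S.rank)
    (γ : Fin T.rank) :
    (S.coeff α : ℂ) * inner ℂ (T.right γ) (S.right α) =
      T.coeff γ * inner ℂ (S.left α) (T.left γ) := by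
  subst h
  -- The contraction of `ψ` with one left vector of `S` and one right vector of `T` can be evaluated
  -- through any decomposition `U`; orthonormality collapses the sum for `U = S` and for `U = T`.
  have key : ∀ (U : SchmidtDecomposition ψ I Iᶜ),
      ∑ x, ∑ y, star (S.left α x) * star (T.right γ y) * ψ.vec (Cfg.glue x y) =
        ∑ ε, (U.coeff ε : ℂ) * inner ℂ (S.left α) (U.left ε) * inner ℂ (T.right γ) (U.right ε) := by
    intro U
    simp only [PiLp.inner_apply, RCLike.inner_apply, U.expansion, res_glue_left, res_glue_right,
      Finset.mul_sum, Finset.sum_mul, starRingEnd_apply]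
    rw [Finset.sum_comm]
    conv_rhs => rw [Finset.sum_comm]
    refine Finset.sum_congr rfl fun y _ => ?_
    rw [Finset.sum_comm]
    refine Finset.sum_congr rfl fun ε _ => Finset.sum_congr rfl fun x _ => ?_
    ring
  have h1 := (key S).symm.trans (key T)
  simpa [orthonormal_iff_ite.mp S.orthonormal_left, orthonormal_iff_ite.mp T.orthonormal_right]
    using h1

/-- The overlaps of the right vectors of two Schmidt decompositions are the complex conjugates of
those of the left vectors. -/
theorem inner_right_eq_inner_left (h : J = Iᶜ) (S T : SchmidtDecomposition ψ I J)
    (α : Fin S.rank) (γ : Fin T.rank) :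
    inner ℂ (T.right γ) (S.right α) = (inner ℂ (S.left α) (T.left γ) : ℂ) := by
  have h1 := coeff_mul_inner h S T α γ
  -- With `x`, `y` the right and left overlaps and `λ`, `μ` the coefficients, `h1` says `λx = μy`,
  -- and the conjugate of the swapped relation says `λy = μx`. Subtracting gives `(λ + μ)(x - y) =
  -- 0`, where `λ + μ > 0`.
  have h2 := coeff_mul_inner (show I = Jᶜ by rw [h, compl_compl]) S.swap T.swap α γ
  have h3 := congrArg (starRingEnd ℂ) h2
  simp only [SchmidtDecomposition.swap, map_mul, Complex.conj_ofReal, inner_conj_symm] at h3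
  have h4 : ((S.coeff α + T.coeff γ : ℝ) : ℂ) ≠ 0 := by
    exact_mod_cast (add_pos (S.coeff_pos α) (T.coeff_pos γ)).ne'
  refine mul_left_cancel₀ h4 ?_
  push_cast
  linear_combination h1 - h3

theorem matElem_ketBra {X : Type*} [Fintype X] (a b u v : EuclideanSpace ℂ X) :
    matElem a (ketBra u v) b = inner ℂ a u * inner ℂ v b := by
  have h1 : ∀ a b : EuclideanSpace ℂ X, star a.ofLp ⬝ᵥ b.ofLp = inner ℂ a b := by
    intro a b
    rw [PiLp.inner_apply]
    simp only [dotProduct, RCLike.inner_apply, starRingEnd_apply, Pi.star_apply, mul_comm]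
  simp only [matElem, ketBra, Matrix.vecMulVec_mulVec, h1]
  simp [mul_comm]

theorem matElem_sum {X ι : Type*} [Fintype X] (s : Finset ι) (u v : EuclideanSpace ℂ X)
    (A : ι → Matrix X X ℂ) : matElem u (∑ i ∈ s, A i) v = ∑ i ∈ s, matElem u (A i) v := by
  simp [matElem, Matrix.sum_mulVec, dotProduct_sum]

/-- The operator with the conjugated matrix elements does not depend on the Schmidt
decomposition. -/
theorem sum_conj_ketBra_eq (h : J = Iᶜ) (S T : SchmidtDecomposition ψ I J) {A : Op d I}
    (hA : A ∈ LinearMap.range (restrict (ψ.reduced I))) (c : ℂ) :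
    ∑ α, ∑ β, (c * starRingEnd ℂ (matElem (T.left α) A (T.left β))) •
        ketBra (T.right α) (T.right β) =
      ∑ α, ∑ β, (c * starRingEnd ℂ (matElem (S.left α) A (S.left β))) •
        ketBra (S.right α) (S.right β) := by
  have h' : I = Jᶜ := by rw [h, compl_compl]
  -- The operator built from `T` is supported on the image of `ρ_J`, so it suffices to compare its
  -- matrix elements in the right basis of `S`; there the overlaps turn into conjugated left
  -- overlaps.
  refine (eq_sum_ketBra h' S.swap (mem_range_restrict h' T.swap
    fun α β => c * starRingEnd ℂ (matElem (T.left α) A (T.left β)))).trans ?_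
  refine Finset.sum_congr rfl fun α _ => Finset.sum_congr rfl fun β _ => ?_
  refine congrArg (fun z : ℂ => z • ketBra (S.right α) (S.right β)) ?_
  conv_rhs => rw [eq_sum_ketBra h T hA]
  simp only [SchmidtDecomposition.swap, matElem_sum, matElem_smul, matElem_ketBra, map_sum,
    map_mul, Finset.mul_sum, inner_conj_symm]
  refine Finset.sum_congr rfl fun γ _ => Finset.sum_congr rfl fun ε _ => ?_
  rw [inner_right_eq_inner_left h T S γ α, inner_right_eq_inner_left h S T β ε]
  ring

end Schmidt

/-! ### The Hodge star as a bijection -/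

section Star

variable {n : ℕ} {d : Fin n → ℕ} (ψ : PureState d) {k : ℕ}

/-- The Hodge star does not depend on the choice of the Schmidt decompositions. -/
theorem hodgeStarOf_eq (S : ∀ J : Finset (Fin n), SchmidtDecomposition ψ Jᶜ J) (hk : k ≤ n) :
    hodgeStarOf ψ S hk = hodgeStar ψ hk := by
  ext1 ω
  funext J
  exact Subtype.ext (sum_conj_ketBra_eq (compl_compl J.1).symm (schmidt ψ J.1) (S J.1)
    (ω ⟨(J.1)ᶜ, card_compl_eq hk J⟩).2 _)

/-- Basis independence allows each component to be computed in whichever decomposition is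
convenient. Taking `I` as a separate index makes a reversed decomposition usable for a second star.
-/
theorem hodgeStar_apply (hk : k ≤ n) (ω : Form ψ k) (I : MultiIndex n k)
    (J : MultiIndex n (n - k)) (h : I.1 = (J.1)ᶜ) (S : SchmidtDecomposition ψ I.1 J.1) :
    (hodgeStar ψ hk ω J : Op d J.1) = ∑ α, ∑ β,
      (shuffleSign I.1 J.1 * starRingEnd ℂ (matElem (S.left α) (ω I : Op d I.1) (S.left β))) •
        ketBra (S.right α) (S.right β) := by
  obtain ⟨I, hI⟩ := I
  dsimp only at h S
  subst h
  exact sum_conj_ketBra_eq (compl_compl J.1).symm S (schmidt ψ J.1) (ω ⟨(J.1)ᶜ, hI⟩).2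
    (shuffleSign (J.1)ᶜ J.1)

variable {ψ}

/-- Transport of forms along an equality of degrees. -/
def Form.cast {l : ℕ} (h : k = l) (ω : Form ψ k) : Form ψ l :=
  fun I => ω ⟨I.1, I.2.trans h.symm⟩

/-- Using `S` for the inner star and `S.swap` for the outer one, the two conjugations cancel and the
original matrix elements return; only the product of the two opposite shuffle signs remains. -/
theorem hodgeStar_hodgeStar (hk : k ≤ n) (ω : Form ψ k) :
    hodgeStar ψ (Nat.sub_le n k) (hodgeStar ψ hk ω) =
      ((-1) ^ (k * (n - k)) : ℂ) • Form.cast (Nat.sub_sub_self hk).symm ω := by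
  funext K
  apply Subtype.ext
  let I : MultiIndex n k := ⟨K.1, K.2.trans (Nat.sub_sub_self hk)⟩
  let J : MultiIndex n (n - k) := ⟨(K.1)ᶜ, by rw [Finset.card_compl, I.2, Fintype.card_fin]⟩
  obtain ⟨S⟩ := nonempty_schmidt ψ (I := I.1) (J := J.1) rfl
  rw [hodgeStar_apply ψ (Nat.sub_le n k) _ J K rfl S.swap,
    hodgeStar_apply ψ hk ω I J (compl_compl _).symm S]
  simp only [SchmidtDecomposition.swap, matElem_sum_ketBra S.orthonormal_right]
  have hs : shuffleSign J.1 K.1 * shuffleSign K.1 J.1 = (-1) ^ (k * (n - k)) := by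
    rw [mul_comm, shuffleSign_mul_swap disjoint_compl_right, J.2, I.2]
  have hc : starRingEnd ℂ (shuffleSign I.1 J.1) = shuffleSign K.1 J.1 := by
    simp [shuffleSign, I]
  simp only [map_mul, Complex.conj_conj, hc, ← mul_assoc, hs]
  change _ = ((-1) ^ (k * (n - k)) : ℂ) • (ω I : Op d I.1)
  conv_rhs => rw [eq_sum_ketBra rfl S (ω I).2]
  simp only [Finset.smul_sum, smul_smul]
  rfl

theorem hodgeStar_cast {l : ℕ} (h : k = l) (hk : k ≤ n) (hl : l ≤ n) (ω : Form ψ k) :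
    hodgeStar ψ hl (Form.cast h ω) = Form.cast (h ▸ rfl) (hodgeStar ψ hk ω) := by
  subst h; rfl

theorem diff_cast {l : ℕ} (h : k = l) (ω : Form ψ k) :
    diff ψ l (Form.cast h ω) = Form.cast (h ▸ rfl) (diff ψ k ω) := by
  subst h; rfl

/-- This exhibits a preimage of `ξ`: its own star, corrected by the sign of the double star in
degree `n - k`. The sign is real, so conjugate-linearity does not alter it. -/
theorem hodgeStar_smul_cast_hodgeStar (hk : k ≤ n) (ξ : Form ψ (n - k)) :
    hodgeStar ψ hk (((-1) ^ ((n - k) * (n - (n - k))) : ℂ) •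
      Form.cast (Nat.sub_sub_self hk) (hodgeStar ψ (Nat.sub_le n k) ξ)) = ξ := by
  rw [map_smulₛₗ, hodgeStar_cast _ (Nat.sub_le _ _), hodgeStar_hodgeStar]
  generalize (n - k) * (n - (n - k)) = m
  change starRingEnd ℂ ((-1) ^ m) • (((-1) ^ m : ℂ) • ξ) = ξ
  rw [smul_smul]
  simp [← mul_pow]

theorem hodgeStar_injective (hk : k ≤ n) : Function.Injective (hodgeStar ψ hk) := by
  intro ω η h
  have h1 := congrArg (hodgeStar ψ (Nat.sub_le n k)) h
  rw [hodgeStar_hodgeStar, hodgeStar_hodgeStar] at h1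
  have h2 := smul_right_injective _ (pow_ne_zero _ (by norm_num)) h1
  funext I
  exact congrFun h2 ⟨I.1, I.2.trans (Nat.sub_sub_self hk).symm⟩

end Star

/-! ### The bilinear pairing of complementary degrees -/

section Pairing

variable {n : ℕ} {d : Fin n → ℕ} {ψ : PureState d} {p q k : ℕ}

/-- In a Schmidt decomposition the expectation value at `ψ` involves `A` only through its matrix
elements between Schmidt vectors, which lie in the image of `ρ_I`. This removes the restriction
built into `diff`. -/
theorem matElem_shuffleTensor_restrict_left {I J : Finset (Fin n)} (hJ : J = Iᶜ)
    (h : I ∪ J = Finset.univ) (A : Op d I) (B : Op d J) :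
    matElem ψ.vec (shuffleTensor h (restrict (ψ.reduced I) A) B) ψ.vec =
      matElem ψ.vec (shuffleTensor h A B) ψ.vec := by
  obtain ⟨S⟩ := nonempty_schmidt ψ hJ
  simp only [matElem_shuffleTensor hJ h S, matElem_restrict hJ S]

theorem matElem_shuffleTensor_restrict_right {I J : Finset (Fin n)} (hJ : J = Iᶜ)
    (h : I ∪ J = Finset.univ) (A : Op d I) (B : Op d J) :
    matElem ψ.vec (shuffleTensor h A (restrict (ψ.reduced J) B)) ψ.vec =
      matElem ψ.vec (shuffleTensor h A B) ψ.vec := by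
  obtain ⟨S⟩ := nonempty_schmidt ψ hJ
  have hr : ∀ α β, matElem (S.right α) (restrict (ψ.reduced J) B) (S.right β) =
      matElem (S.right α) B (S.right β) :=
    matElem_restrict (show I = Jᶜ by rw [hJ, compl_compl]) S.swap B
  simp only [matElem_shuffleTensor hJ h S, hr]

theorem shuffleTensor_sum_right {I J K : Finset (Fin n)} (h : I ∪ J = K) {ι : Type*}
    (s : Finset ι) (A : Op d I) (B : ι → Op d J) :
    shuffleTensor h A (∑ i ∈ s, B i) = ∑ i ∈ s, shuffleTensor h A (B i) :=
  map_sum (AddMonoidHom.mk' (shuffleTensor h A) (shuffleTensor_add h A)) B s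

theorem shuffleTensor_sum_left {I J K : Finset (Fin n)} (h : I ∪ J = K) {ι : Type*}
    (s : Finset ι) (A : ι → Op d I) (B : Op d J) :
    shuffleTensor h (∑ i ∈ s, A i) B = ∑ i ∈ s, shuffleTensor h (A i) B := by
  refine map_sum (AddMonoidHom.mk' (fun A => shuffleTensor h A B) fun A A' => ?_) A s
  unfold shuffleTensor
  split_ifs
  · ext x y; simp [add_mul, mul_add]
  · simp

theorem shuffleTensor_smul_left {I J K : Finset (Fin n)} (h : I ∪ J = K) (c : ℂ) (A : Op d I)
    (B : Op d J) : shuffleTensor h (c • A) B = c • shuffleTensor h A B := by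
  unfold shuffleTensor
  split_ifs
  · ext x y; simp; ring
  · simp

/-- The pairing `tr (ω ∧ ζ)|_ρ` of forms of complementary degrees. -/
def pairing (h : p + q = n) (ω : Form ψ p) (ζ : Form ψ q) : ℂ :=
  ∑ J : MultiIndex n q, matElem ψ.vec
    (shuffleTensor (show (J.1)ᶜ ∪ J.1 = Finset.univ by rw [Finset.union_comm, Finset.union_compl])
      (ω ⟨(J.1)ᶜ, by rw [Finset.card_compl, J.2, Fintype.card_fin]; omega⟩ : Op d _)
      (ζ J : Op d _)) ψ.vec

theorem pairing_zero (h : p + q = n) (ω : Form ψ p) : pairing h ω (0 : Form ψ q) = 0 := by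
  refine Finset.sum_eq_zero fun J _ => ?_
  have h0 : ((0 : Form ψ q) J : Op d J.1) = (0 : ℂ) • 0 := (zero_smul ℂ _).symm
  rw [h0, shuffleTensor_smul, matElem_smul, zero_mul]

/-- The sign in the star cancels the sign of the shuffled product, leaving the Schmidt expression of
the inner product. -/
theorem hodgeInner_eq_pairing (hk : k ≤ n) (ω η : Form ψ k) :
    hodgeInner hk ω η = pairing (Nat.add_sub_of_le hk) ω (hodgeStar ψ hk η) := by
  rw [hodgeInner_eq, pairing]
  refine Finset.sum_congr rfl fun J _ => ?_
  rw [matElem_shuffleTensor (compl_compl J.1).symm _ (schmidt ψ J.1), Finset.mul_sum]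
  refine Finset.sum_congr rfl fun α _ => ?_
  rw [Finset.mul_sum]
  refine Finset.sum_congr rfl fun β _ => ?_
  have hst : matElem ((schmidt ψ J.1).right α) (hodgeStar ψ hk η J : Op d _)
      ((schmidt ψ J.1).right β) = shuffleSign (J.1)ᶜ J.1 *
        starRingEnd ℂ (matElem ((schmidt ψ J.1).left α)
          (η ⟨(J.1)ᶜ, card_compl_eq hk J⟩ : Op d _) ((schmidt ψ J.1).left β)) :=
    matElem_sum_ketBra (schmidt ψ J.1).orthonormal_right _ α β
  rw [hst]
  linear_combination (-((schmidt ψ J.1).coeff α : ℂ) * (schmidt ψ J.1).coeff β *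
    (matElem ((schmidt ψ J.1).left α) (ω ⟨(J.1)ᶜ, card_compl_eq hk J⟩ : Op d _)
        ((schmidt ψ J.1).left β) *
      starRingEnd ℂ (matElem ((schmidt ψ J.1).left α)
        (η ⟨(J.1)ᶜ, card_compl_eq hk J⟩ : Op d _) ((schmidt ψ J.1).left β)))) *
    shuffleSign_mul_self (J.1)ᶜ J.1

theorem eq_zero_of_hodgeInner_self (hk : k ≤ n) {ω : Form ψ k} (h : hodgeInner hk ω ω = 0) :
    ω = 0 :=
  (innerCore ψ hk).definite ω h

theorem hodgeInner_conj (hk : k ≤ n) (ω η : Form ψ k) :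
    starRingEnd ℂ (hodgeInner hk ω η) = hodgeInner hk η ω :=
  (innerCore ψ hk).conj_inner_symm ω η

/-- Write `ξ = *θ` by surjectivity of the star and test against `θ`: the pairing becomes `⟨θ, θ⟩`,
and definiteness applies. -/
theorem eq_zero_of_pairing (h : p + q = n) (ξ : Form ψ q)
    (hξ : ∀ η : Form ψ p, pairing h η ξ = 0) : ξ = 0 := by
  obtain rfl : q = n - p := by omega
  have hp : p ≤ n := by omega
  obtain ⟨θ, rfl⟩ : ∃ θ, hodgeStar ψ hp θ = ξ := ⟨_, hodgeStar_smul_cast_hodgeStar hp ξ⟩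
  have h1 : hodgeInner hp θ θ = 0 := (hodgeInner_eq_pairing hp θ θ).trans (hξ θ)
  rw [eq_zero_of_hodgeInner_self hp h1, map_zero]

/-! ### Moving the coboundary operator across the pairing -/

/-- The components of a form, extended by zero to all sets of subsystems. -/
def Form.total (ω : Form ψ k) (I : Finset (Fin n)) : Op d I :=
  if h : I.card = k then (ω ⟨I, h⟩ : Op d I) else 0

theorem Form.total_eq (ω : Form ψ k) (I : MultiIndex n k) : ω.total I.1 = (ω I : Op d I.1) :=
  dif_pos I.2

/-- The matrix element of the unsigned product of `𝟙_j`, an operator on `H_I` and an operator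
on `H_J`. -/
def tripleElem (ψ : PureState d) (j : Fin n) {I J : Finset (Fin n)} (A : Op d I) (B : Op d J) : ℂ :=
  matElem ψ.vec (Matrix.of fun x y =>
    (1 : Op d {j}) (Cfg.res (Finset.subset_univ _) x) (Cfg.res (Finset.subset_univ _) y) *
      A (Cfg.res (Finset.subset_univ _) x) (Cfg.res (Finset.subset_univ _) y) *
      B (Cfg.res (Finset.subset_univ _) x) (Cfg.res (Finset.subset_univ _) y)) ψ.vec

/-- Apart from signs, the triple product does not remember whether `𝟙_j` was attached to `A` or to
`B`. Together with `matElem_shuffleTensor_one_right`, this is what lets `d` change sides. -/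
theorem matElem_shuffleTensor_one_left {I J : Finset (Fin n)} {j : Fin n} (hIJ : Disjoint I J)
    (h : I ∪ J = Finset.univ) (hj : j ∈ I) (A : Op d (I.erase j)) (B : Op d J) :
    matElem ψ.vec (shuffleTensor h
        (shuffleTensor (singleton_union_erase hj) (1 : Op d {j}) A) B) ψ.vec =
      shuffleSign I J * shuffleSign {j} (I.erase j) * tripleElem ψ j A B := by
  rw [tripleElem, ← matElem_smul]
  congr 1
  unfold shuffleTensor
  rw [if_pos hIJ, if_pos (Finset.disjoint_singleton_left.mpr (Finset.notMem_erase j I))]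
  ext x y
  simp only [Matrix.smul_apply, Matrix.of_apply, smul_eq_mul]
  simp only [mul_assoc]
  rfl

theorem matElem_shuffleTensor_one_right {I J : Finset (Fin n)} {j : Fin n} (hIJ : Disjoint I J)
    (h : I ∪ J = Finset.univ) (hj : j ∈ J) (A : Op d I) (B : Op d (J.erase j)) :
    matElem ψ.vec (shuffleTensor h A
        (shuffleTensor (singleton_union_erase hj) (1 : Op d {j}) B)) ψ.vec =
      shuffleSign I J * shuffleSign {j} (J.erase j) * tripleElem ψ j A B := by
  rw [tripleElem, ← matElem_smul]
  congr 1
  unfold shuffleTensor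
  rw [if_pos hIJ, if_pos (Finset.disjoint_singleton_left.mpr (Finset.notMem_erase j J))]
  ext x y
  simp only [Matrix.smul_apply, Matrix.of_apply, smul_eq_mul]
  rw [mul_assoc (shuffleSign I J)]
  refine congrArg (shuffleSign I J * ·) ?_
  rw [mul_left_comm]
  refine congrArg (shuffleSign {j} (J.erase j) * ·) ?_
  rw [mul_left_comm, ← mul_assoc]
  rfl

/-- The numerical factor `c_k` of the coboundary operator. -/
def diffCoeff (k : ℕ) : ℂ := if k = 0 then 1 else k

theorem diffCoeff_ne_zero (k : ℕ) : diffCoeff k ≠ 0 := by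
  unfold diffCoeff
  split_ifs with h
  · exact one_ne_zero
  · exact_mod_cast h

/-- Stated with `Form.total`, so that the summands carry no cardinality proofs and can be matched
with those of `pairing_diff_right` by rewriting sets. -/
theorem pairing_diff_left (h : p + 1 + q = n) (η : Form ψ p) (ζ : Form ψ q) :
    pairing h (diff ψ p η) ζ = diffCoeff p *
      ∑ J : MultiIndex n q, ∑ j : {j : Fin n // j ∈ (J.1)ᶜ},
        shuffleSign (J.1)ᶜ J.1 * shuffleSign {j.1} ((J.1)ᶜ.erase j.1) *
          tripleElem ψ j.1 (η.total ((J.1)ᶜ.erase j.1)) (ζ.total J.1) := by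
  rw [pairing, Finset.mul_sum]
  refine Finset.sum_congr rfl fun J _ => ?_
  refine (matElem_shuffleTensor_restrict_left (compl_compl J.1).symm _ _ _).trans ?_
  rw [shuffleTensor_smul_left, matElem_smul, shuffleTensor_sum_left, matElem_sum]
  refine congrArg (diffCoeff p * ·) (Finset.sum_congr rfl fun j _ => ?_)
  rw [matElem_shuffleTensor_one_left disjoint_compl_left _ j.2, Form.total_eq ζ J]
  rw [← Form.total_eq η]

theorem pairing_diff_right (h : p + (q + 1) = n) (η : Form ψ p) (ζ : Form ψ q) :
    pairing h η (diff ψ q ζ) = diffCoeff q *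
      ∑ K : MultiIndex n (q + 1), ∑ j : {j : Fin n // j ∈ K.1},
        shuffleSign (K.1)ᶜ K.1 * shuffleSign {j.1} (K.1.erase j.1) *
          tripleElem ψ j.1 (η.total (K.1)ᶜ) (ζ.total (K.1.erase j.1)) := by
  rw [pairing, Finset.mul_sum]
  refine Finset.sum_congr rfl fun K _ => ?_
  refine (matElem_shuffleTensor_restrict_right (compl_compl K.1).symm _ _ _).trans ?_
  rw [shuffleTensor_smul, matElem_smul, shuffleTensor_sum_right, matElem_sum]
  refine congrArg (diffCoeff q * ·) (Finset.sum_congr rfl fun j _ => ?_)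
  rw [matElem_shuffleTensor_one_right disjoint_compl_left _ j.2]
  rw [← Form.total_eq η, ← Form.total_eq ζ]

/-- Adding a point of the complement to a set, as a bijection between pointed sets. -/
def insertEquiv (n q : ℕ) : (Σ J : MultiIndex n q, {j : Fin n // j ∈ (J.1)ᶜ}) ≃
    Σ K : MultiIndex n (q + 1), {j : Fin n // j ∈ K.1} where
  toFun x := ⟨⟨insert x.2.1 x.1.1, by
      rw [Finset.card_insert_of_notMem (Finset.mem_compl.mp x.2.2), x.1.2]⟩,
    ⟨x.2.1, Finset.mem_insert_self _ _⟩⟩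
  invFun y := ⟨⟨y.1.1.erase y.2.1, by
      rw [Finset.card_erase_of_mem y.2.2, y.1.2, Nat.add_sub_cancel]⟩,
    ⟨y.2.1, Finset.mem_compl.mpr (Finset.notMem_erase _ _)⟩⟩
  left_inv := by
    rintro ⟨⟨J, hJ⟩, ⟨j, hj⟩⟩
    have e : (insert j J).erase j = J := Finset.erase_insert (Finset.mem_compl.mp hj)
    simp only [Sigma.mk.injEq, Subtype.mk.injEq]
    exact ⟨e, (Subtype.heq_iff_coe_eq fun x => by rw [e]).mpr rfl⟩
  right_inv := by
    rintro ⟨⟨K, hK⟩, ⟨j, hj⟩⟩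
    have e : insert j (K.erase j) = K := Finset.insert_erase hj
    simp only [Sigma.mk.injEq, Subtype.mk.injEq]
    exact ⟨e, (Subtype.heq_iff_coe_eq fun x => by rw [e]).mpr rfl⟩

/-- The coboundary operator is, up to a nonzero factor, its own transpose for the pairing. -/
theorem pairing_diff (h : p + 1 + q = n) (h' : p + (q + 1) = n) (η : Form ψ p) (ζ : Form ψ q) :
    diffCoeff q * pairing h (diff ψ p η) ζ =
      (-1) ^ p * diffCoeff p * pairing h' η (diff ψ q ζ) := by
  rw [pairing_diff_left, pairing_diff_right, ← Fintype.sum_sigma', ← Fintype.sum_sigma',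
    ← (insertEquiv n q).sum_comp, mul_left_comm (diffCoeff q), mul_comm ((-1 : ℂ) ^ p), mul_assoc,
    mul_left_comm ((-1 : ℂ) ^ p)]
  refine congrArg (diffCoeff p * ·) (congrArg (diffCoeff q * ·) ?_)
  rw [Finset.mul_sum]
  refine Finset.sum_congr rfl fun x _ => ?_
  obtain ⟨⟨J, hJ⟩, ⟨j, hj⟩⟩ := x
  have hj' : j ∉ J := Finset.mem_compl.mp hj
  -- The partition is `{j} ⊔ A ⊔ J` with `A = Jᶜ.erase j`. Here `A` has `n - q - 1 = p` elements,
  -- whence the sign `(-1) ^ p`, and it is also the complement of `insert j J`.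
  have hs := shuffleSign_singleton_comm (Finset.notMem_erase j Jᶜ) hj'
  rw [Finset.card_erase_of_mem hj, Finset.card_compl, hJ, Fintype.card_fin,
    show n - q - 1 = p by omega, singleton_union_erase hj, ← Finset.insert_eq] at hs
  simp only [insertEquiv, Equiv.coe_fn_mk]
  rw [Finset.compl_insert, Finset.erase_insert hj', hs]
  ring

end Pairing

/-! ### Harmonic forms and duality -/

section Harmonic

variable {n : ℕ} {d : Fin n → ℕ} {ψ : PureState d} {k : ℕ}

theorem hodgeInner_codiff (hk : k + 1 ≤ n) (ω : Form ψ (k + 1)) (η : Form ψ k) :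
    hodgeInner hk ω (diff ψ k η) = hodgeInner (Nat.le_of_succ_le hk) (codiff ψ hk ω) η :=
  (exists_codiff ψ hk).choose_spec.1 ω η

/-- A form is coclosed if and only if its Hodge star is closed. -/
theorem codiff_eq_zero_iff (hk : k + 1 ≤ n) (ω : Form ψ (k + 1)) :
    codiff ψ hk ω = 0 ↔ diff ψ (n - (k + 1)) (hodgeStar ψ hk ω) = 0 := by
  have h : k + (n - (k + 1) + 1) = n := by omega
  -- Conjugate symmetry puts `dη` in the first slot, so that `⟨dη, ω⟩` is the pairing of `dη` with
  -- `*ω`; transposing `d` costs only nonzero factors, which do not affect vanishing.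
  have key : ∀ η : Form ψ k, hodgeInner (Nat.le_of_succ_le hk) (codiff ψ hk ω) η = 0 ↔
      pairing h η (diff ψ _ (hodgeStar ψ hk ω)) = 0 := by
    intro η
    rw [← hodgeInner_codiff, ← hodgeInner_conj, map_eq_zero, hodgeInner_eq_pairing,
      ← mul_eq_zero_iff_left (diffCoeff_ne_zero (n - (k + 1))), pairing_diff _ h,
      mul_eq_zero_iff_left (mul_ne_zero (pow_ne_zero _ (by norm_num)) (diffCoeff_ne_zero k))]
  refine ⟨fun h0 => eq_zero_of_pairing h _ fun η => (key η).mp ?_,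
    fun h0 => eq_zero_of_hodgeInner_self (Nat.le_of_succ_le hk) ((key _).mpr ?_)⟩
  · rw [h0]
    rw [← hodgeInner_conj, hodgeInner_eq_pairing, map_zero, pairing_zero, map_zero]
  · rw [h0, pairing_zero]

/-- This replaces the degree-dependent condition on `δ` by one uniform in `k` and visibly symmetric
under the star. -/
theorem mem_harmonic_iff (hk : k ≤ n) (ω : Form ψ k) :
    ω ∈ harmonic ψ k hk ↔ diff ψ k ω = 0 ∧ diff ψ (n - k) (hodgeStar ψ hk ω) = 0 := by
  cases k with
  | zero =>
    have h : diff ψ (n - 0) (hodgeStar ψ hk ω) = 0 := by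
      -- In degree zero the condition on the star is vacuous: its coboundary has degree `n + 1`, and
      -- no set of subsystems is that large.
      funext K
      exact absurd (Finset.card_le_univ K.1) (by rw [K.2, Fintype.card_fin]; omega)
    exact ⟨fun hω => ⟨hω, h⟩, fun hω => hω.1⟩
  | succ k => exact and_congr Iff.rfl (codiff_eq_zero_iff hk ω)

theorem diff_hodgeStar_hodgeStar_eq_zero_iff (hk : k ≤ n) (ω : Form ψ k) :
    diff ψ _ (hodgeStar ψ (Nat.sub_le n k) (hodgeStar ψ hk ω)) = 0 ↔ diff ψ k ω = 0 := by
  have hc : ∀ {l m : ℕ} (h : l = m) (η : Form ψ l), Form.cast h η = 0 ↔ η = 0 := by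
    intro l m h η; subst h; rfl
  rw [hodgeStar_hodgeStar, map_smul, diff_cast,
    smul_eq_zero_iff_right (pow_ne_zero _ (by norm_num)), hc]

theorem hodgeStar_mem_harmonic_iff (hk : k ≤ n) (ω : Form ψ k) :
    hodgeStar ψ hk ω ∈ harmonic ψ (n - k) (Nat.sub_le n k) ↔ ω ∈ harmonic ψ k hk := by
  -- For `*ω` the two closedness conditions concern `*ω` and `**ω`; the latter is `ω` up to sign, so
  -- they are those for `ω` in the other order.
  rw [mem_harmonic_iff, mem_harmonic_iff, diff_hodgeStar_hodgeStar_eq_zero_iff, and_comm]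

theorem bijOn_hodgeStar (ψ : PureState d) (hk : k ≤ n) :
    Set.BijOn (hodgeStar ψ hk) (harmonic ψ k hk) (harmonic ψ (n - k) (Nat.sub_le n k)) := by
  refine ⟨fun ω hω => (hodgeStar_mem_harmonic_iff hk ω).mpr hω, (hodgeStar_injective hk).injOn,
    fun ξ hξ => ?_⟩
  obtain ⟨θ, rfl⟩ : ∃ θ, hodgeStar ψ hk θ = ξ := ⟨_, hodgeStar_smul_cast_hodgeStar hk ξ⟩
  exact ⟨θ, (hodgeStar_mem_harmonic_iff hk θ).mp hξ, rfl⟩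

/-- The restricted star is a bijection semilinear over complex conjugation, an automorphism of `ℂ`,
so it preserves rank; vector spaces of equal rank are linearly isomorphic. -/
theorem nonempty_harmonic_equiv (ψ : PureState d) (hk : k ≤ n) :
    Nonempty (harmonic ψ k hk ≃ₗ[ℂ] harmonic ψ (n - k) (Nat.sub_le n k)) := by
  let f : harmonic ψ k hk →ₛₗ[starRingEnd ℂ] harmonic ψ (n - k) (Nat.sub_le n k) :=
    ((hodgeStar ψ hk).comp (harmonic ψ k hk).subtype).codRestrict _
      fun ω => (hodgeStar_mem_harmonic_iff hk ω.1).mpr ω.2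
  have hf : Function.Bijective f := by
    refine ⟨fun a b hab => Subtype.ext (hodgeStar_injective hk (congrArg Subtype.val hab)),
      fun ξ => ?_⟩
    obtain ⟨θ, hθ, h⟩ := (bijOn_hodgeStar ψ hk).surjOn ξ.2
    exact ⟨⟨θ, hθ⟩, Subtype.ext h⟩
  have h1 := Module.Free.of_divisionRing ℂ (harmonic ψ k hk)
  have h2 := Module.Free.of_divisionRing ℂ (harmonic ψ (n - k) (Nat.sub_le n k))
  exact nonempty_linearEquiv_of_rank_eq (rank_eq_of_equiv_equiv (starRingEnd ℂ)
    (AddEquiv.ofBijective f hf) star_involutive.bijective fun r m => map_smulₛₗ f r m)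

end Harmonic

end

end EntanglementHodge

theorem mainTheorem2 {n : ℕ} {d : Fin n → ℕ} (ψ : EntanglementHodge.PureState d) (k : ℕ)
    (hk : k ≤ n) :
    (∀ S : (∀ J : Finset (Fin n), EntanglementHodge.SchmidtDecomposition ψ Jᶜ J),
      EntanglementHodge.hodgeStarOf ψ S hk = EntanglementHodge.hodgeStar ψ hk) ∧
    Set.BijOn (EntanglementHodge.hodgeStar ψ hk)
      (EntanglementHodge.harmonic ψ k hk : Set (EntanglementHodge.Form ψ k))
      (EntanglementHodge.harmonic ψ (n - k) (Nat.sub_le n k) :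
        Set (EntanglementHodge.Form ψ (n - k))) ∧
    Nonempty (EntanglementHodge.harmonic ψ k hk ≃ₗ[ℂ]
      EntanglementHodge.harmonic ψ (n - k) (Nat.sub_le n k)) :=
  ⟨fun S => EntanglementHodge.hodgeStarOf_eq ψ S hk, EntanglementHodge.bijOn_hodgeStar ψ hk,
    EntanglementHodge.nonempty_harmonic_equiv ψ hk⟩
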